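/- Let $\mathbb N=\{1,2,\dots\}$. \textbf{Arrow systems.} An arrow system is a family $\mathcal E=(\mathcal E(x,r))_{x\in\mathbb Z,\,r\in\mathbb N}$ with values in $\{\leftarrow,\rightarrow\}$. Let $\mathcal E_{\leftarrow}(x,r)$ be the number of left arrows among $\mathcal E(x,1),\dots,\mathcal E(x,r)$. Write $\mathcal L\preccurlyeq\mathcal R$ if $\mathcal L_{\leftarrow}(x,r)\ge\mathcal R_{\leftarrow}(x,r)$ for all $x\in\mathbb Z$, $r\in\mathbb N$. An arrow system $\mathcal E$ determines an integer sequence $(E_n)_{n\ge0}$ by $E_0=0$ and, with $k=\#\{0\le m\le n:E_m=E_n\}$, $E_{n+1}=E_n+1$ if $\mathcal E(E_n,k)=\rightarrow$ and $E_{n+1}=E_n-1$ if $\mathcal E(E_n,k)=\leftarrow$. For integer sequences $L,R$ write $L\preccurlyeq R$ if there are arrow systems $\mathcal L\preccurlyeq\mathcal R$ that determine $L$ and $R$ respectively. \textbf{Excited random walks.} A cookie environment is an element $\omega=(\omega(x,n))_{x\in\mathbb Z,\,n\in\mathbb N}$ of $[0,1]^{\mathbb Z\times\mathbb N}$. An excited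 random walk in environment $\omega$ is a sequence $(X_n)_{n\ge 0}$ of $\mathbb Z$-valued random variables on a probability space, adapted to some filtration $(\mathcal F_n)_{n\ge0}$, such that $X_0=0$ a.s. and, for all $n\ge0$, almost surely $$P(X_{n+1}=X_n+1\mid\mathcal F_n)=\omega(X_n,\ell(n))=1-P(X_{n+1}=X_n-1\mid\mathcal F_n),\qquad \ell(n)=\#\{0\le m\le n:X_m=X_n\}.$$ \textbf{Favourable swaps.} Let $\mathcal A=(\mathcal A_x)_{x\in\mathbb Z}$, where each $\mathcal A_x$ is a partition of $\mathbb N$ into finite non-empty sets (blocks). For a block $A\in\mathcal A_x$ and $\eta\in[0,1]^A$, a favourable swap of $\eta$ is a pair $j\le k$ in $A$ with $\eta(j)\le\eta(k)$; it produces the element of $[0,1]^A$ obtained from $\eta$ by exchanging the values at $j$ and $k$. Write $\omega\preccurlyeq^{\mathcal A}\omega'$ if, for every $x\in\mathbb Z$ and every block $A\in\mathcal A_x$, the restriction $(\omega'(x,r))_{r\in A}$ is a permutation of $(\omega(x,r))_{r\in A}$ and can be obtained from it by a finite (possibly empty) sequence of swaps, each favourable for the element of $[0,1]^A$ to which it is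 applied. \textbf{Theorem.} Let $\mathcal A$ be as above and let $\omega,\omega'$ be cookie environments with $\omega\preccurlyeq^{\mathcal A}\omega'$. Then there exists a probability space on which there are excited random walks $E_\omega$ and $E_{\omega'}$ in environments $\omega$ and $\omega'$ respectively such that $E_\omega\preccurlyeq E_{\omega'}$ almost surely. -/

import Mathlib

open MeasureTheory

/-- The two possible directions of an arrow. -/
inductive Arrow where
  | left : Arrow
  | right : Arrow
  deriving DecidableEq

/-- An arrow system: `E x r` is the arrow above the vertex `x` at level `r = 1, 2, …`. -/
abbrev ArrowSystem : Type := ℤ → ℕ+ → Arrow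

namespace ArrowSystem

/-- The number of left arrows among the first `r` arrows above `j`. -/
def leftCount (E : ArrowSystem) (j : ℤ) (r : ℕ+) : ℕ :=
  ((Finset.Icc 1 r).filter (fun i => E j i = Arrow.left)).card

/-- The order `L ≼ R` on arrow systems: among the first `r` arrows above `j`, `L` has at least as
many left arrows as `R`, for all `j` and `r`. -/
def Preceq (L R : ArrowSystem) : Prop :=
  ∀ (j : ℤ) (r : ℕ+), R.leftCount j r ≤ L.leftCount j r

end ArrowSystem

/-- The number of visits `#{0 ≤ m ≤ n : X m = X n}` up to time `n` to the location at time `n`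
(at least one, since `m = n` counts). -/
def visitNumber (X : ℕ → ℤ) (n : ℕ) : ℕ+ :=
  ⟨((Finset.range (n + 1)).filter (fun m => X m = X n)).card,
    Finset.card_pos.mpr ⟨n, by simp⟩⟩

/-- `X` is the sequence determined by the arrow system `E`: it starts at `0`, and at its `k`-th
visit to a site it follows the `k`-th arrow above that site. -/
def ArrowSystem.IsPath (E : ArrowSystem) (X : ℕ → ℤ) : Prop :=
  X 0 = 0 ∧ ∀ n : ℕ,
    X (n + 1) = if E (X n) (visitNumber X n) = Arrow.right then X n + 1 else X n - 1

/-- The relation `L ≼ R` on integer sequences: they are the sequences determined by some arrow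
systems `𝓛 ≼ 𝓡`. -/
def PathPreceq (L R : ℕ → ℤ) : Prop :=
  ∃ 𝓛 𝓡 : ArrowSystem, 𝓛.Preceq 𝓡 ∧ 𝓛.IsPath L ∧ 𝓡.IsPath R

/-- A cookie environment: `ω x n ∈ [0,1]` is the `n`-th cookie at site `x`, for `n = 1, 2, …`. -/
abbrev CookieEnv : Type := ℤ → ℕ+ → unitInterval

/-- `X` is an excited random walk in the cookie environment `ω` under `μ`: it starts at `0` and is
adapted to a filtration given which, at each time `n`, it steps to the right with probability
`ω x k` and to the left with probability `1 - ω x k`, where `x = X n` and time `n` is the `k`-th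
visit to `x`. -/
def IsExcitedRandomWalk {Ω : Type*} [m : MeasurableSpace Ω] (ω : CookieEnv) (X : ℕ → Ω → ℤ)
    (μ : Measure Ω) : Prop :=
  ∃ ℱ : Filtration ℕ m, StronglyAdapted ℱ X ∧ (∀ᵐ z ∂μ, X 0 z = 0) ∧ ∀ n : ℕ,
    (μ[Set.indicator {z | X (n + 1) z = X n z + 1} (fun _ => (1 : ℝ)) | ℱ n]
      =ᵐ[μ] fun z => (ω (X n z) (visitNumber (fun i => X i z) n) : ℝ)) ∧
    (μ[Set.indicator {z | X (n + 1) z = X n z - 1} (fun _ => (1 : ℝ)) | ℱ n]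
      =ᵐ[μ] fun z => 1 - (ω (X n z) (visitNumber (fun i => X i z) n) : ℝ))

/-- For every site `x`, `𝒜 x` is a partition of `{1, 2, …}` into finite nonempty sets. -/
def IsBlockPartition (𝒜 : ℤ → Set (Set ℕ+)) : Prop :=
  ∀ x : ℤ, Setoid.IsPartition (𝒜 x) ∧ ∀ A ∈ 𝒜 x, A.Finite

/-- The restriction `ω(x, A)` of the pile of cookies at `x` to the levels in `A`. -/
def CookieEnv.block (ω : CookieEnv) (x : ℤ) (A : Set ℕ+) : A → unitInterval :=
  fun r => ω x r

/-- `η'` is produced from the block `η` by one favourable swap `(j, k)`: `j ≤ k`, `η j ≤ η k`, and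
the entries at `j` and `k` are exchanged. -/
def FavourableSwap {A : Set ℕ+} (η η' : A → unitInterval) : Prop :=
  ∃ j k : A, j ≤ k ∧ η j ≤ η k ∧ η' j = η k ∧ η' k = η j ∧ ∀ r : A, r ≠ j → r ≠ k → η' r = η r

/-- `ω'` is an `𝒜`-permutation of `ω`: on every block, it is a permutation of `ω`. -/
def IsBlockPermutation (𝒜 : ℤ → Set (Set ℕ+)) (ω ω' : CookieEnv) : Prop :=
  ∀ x : ℤ, ∀ A ∈ 𝒜 x, ∃ σ : Equiv.Perm A, ∀ r : A, ω'.block x A r = ω.block x A (σ r)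

/-- `ω ≼ ω'` relative to `𝒜`: `ω'` is an `𝒜`-permutation of `ω` and, on every block, it is
generated from `ω` by a finite (possibly empty) sequence of favourable swaps, each one favourable
for the block environment to which it is applied. -/
def CookieEnv.BlockPreceq (𝒜 : ℤ → Set (Set ℕ+)) (ω ω' : CookieEnv) : Prop :=
  IsBlockPermutation 𝒜 ω ω' ∧
    ∀ x : ℤ, ∀ A ∈ 𝒜 x, Relation.ReflTransGen FavourableSwap (ω.block x A) (ω'.block x A)

/-!
Arrows chosen independently, the arrow at `(x, r)` pointing right with probability `ω x r`,
determine an excited random walk in the environment `ω` (`isExcitedRandomWalk_path`): no arrow is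
used twice, so the arrow used at time `n` is independent of the event that the walk has followed a
given trajectory up to time `n`. It therefore suffices to couple two such random arrow systems, for
`ω` and for `ω'`, so that the first is almost surely `≼` the second.

The coupling is built block by block, and the blocks are then made independent. Within a block, a
favourable swap of `j ≤ k` exchanges a probability `η j` with a probability `η k ≥ η j`. Hence a
configuration with a left arrow at `j` and a right arrow at `k` is at least as likely as the one
with these two arrows exchanged. Moving the excess probability from the former to the latter
replaces the law for `η` by the law for the swapped environment
(`PMF.exists_kernel_of_involutive`), and it only ever moves a left arrow from level `j` to the
higher level `k`, which lowers all the counts of left arrows up to a given level, weakly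
(`FavourableSwap.exists_kernel`). These random moves are Markov kernels, so that composing them
handles a finite sequence of swaps (`exists_coupling_of_reflTransGen`). Finally, the number of left
arrows among the first `r` is the sum over the blocks of the corresponding counts
(`ArrowSystem.preceq_of_blockArrowsLE`).
-/

open ProbabilityTheory

/-! ### The walk determined by an arrow system -/

instance : MeasurableSpace Arrow := ⊤

instance : DiscreteMeasurableSpace Arrow := ⟨fun _ => trivial⟩

instance : Finite Arrow :=
  Finite.of_surjective (fun b : Bool => if b then Arrow.left else Arrow.right) fun a => by
    cases a
    exacts [⟨true, rfl⟩, ⟨false, rfl⟩]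

theorem Arrow.ne_right_iff {a : Arrow} : a ≠ Arrow.right ↔ a = Arrow.left := by
  cases a <;> simp

/-- The number of visits depends only on the trajectory up to the present time. -/
theorem visitNumber_congr {X Y : ℕ → ℤ} {n : ℕ} (h : ∀ m ≤ n, X m = Y m) :
    visitNumber X n = visitNumber Y n := by
  apply PNat.eq
  simp only [visitNumber, PNat.mk_coe]
  congr 1
  refine Finset.filter_congr fun m hm => ?_
  rw [h m (Nat.lt_succ_iff.mp (Finset.mem_range.mp hm)), h n le_rfl]

/-- Distinct times use distinct arrows. -/
theorem visitNumber_lt {X : ℕ → ℤ} {m n : ℕ} (hmn : m < n) (h : X m = X n) :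
    visitNumber X m < visitNumber X n := by
  rw [← PNat.coe_lt_coe]
  simp only [visitNumber, PNat.mk_coe]
  refine Finset.card_lt_card (Finset.ssubset_iff_of_subset (fun i hi => ?_) |>.mpr ⟨n, ?_, ?_⟩)
  · simp only [Finset.mem_filter, Finset.mem_range] at hi ⊢
    exact ⟨by omega, hi.2.trans h⟩
  · simp
  · simp only [Finset.mem_filter, Finset.mem_range]
    omega

namespace ArrowSystem

/-- The trajectory up to time `n` determined by an arrow system, continued by the value `0`. -/
def pathUpTo (E : ArrowSystem) : ℕ → ℕ → ℤ
  | 0 => fun _ => 0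
  | n + 1 => Function.update (E.pathUpTo n) (n + 1)
      (if E (E.pathUpTo n n) (visitNumber (E.pathUpTo n) n) = Arrow.right
        then E.pathUpTo n n + 1 else E.pathUpTo n n - 1)

/-- The sequence determined by an arrow system. -/
def path (E : ArrowSystem) (n : ℕ) : ℤ := E.pathUpTo n n

theorem pathUpTo_eq_path (E : ArrowSystem) {m n : ℕ} (h : m ≤ n) :
    E.pathUpTo n m = E.path m := by
  induction n with
  | zero => rw [Nat.le_zero.mp h]; rfl
  | succ n ih =>
    rcases h.lt_or_eq with h | rfl
    · rw [← ih (by omega), pathUpTo, Function.update_of_ne (by omega)]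
    · rfl

theorem isPath_path (E : ArrowSystem) : E.IsPath E.path := by
  refine ⟨rfl, fun n => ?_⟩
  rw [← visitNumber_congr fun m hm => E.pathUpTo_eq_path hm]
  simp only [path, pathUpTo, Function.update_self]
  rfl

/-- The arrow followed at time `n`. -/
def arrowAt (E : ArrowSystem) (X : ℕ → ℤ) (n : ℕ) : Arrow := E (X n) (visitNumber X n)

theorem arrowAt_congr (E : ArrowSystem) {X Y : ℕ → ℤ} {n : ℕ} (h : ∀ m ≤ n, X m = Y m) :
    E.arrowAt X n = E.arrowAt Y n := by
  rw [arrowAt, arrowAt, visitNumber_congr h, h n le_rfl]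

theorem path_succ (E : ArrowSystem) (n : ℕ) :
    E.path (n + 1) =
      if E.arrowAt E.path n = Arrow.right then E.path n + 1 else E.path n - 1 :=
  E.isPath_path.2 n

theorem path_succ_eq_add_one_iff (E : ArrowSystem) (n : ℕ) :
    E.path (n + 1) = E.path n + 1 ↔ E.arrowAt E.path n = Arrow.right := by
  rw [path_succ]
  split_ifs with h
  · simp [h]
  · simp only [h, iff_false]; omega

theorem path_succ_eq_sub_one_iff (E : ArrowSystem) (n : ℕ) :
    E.path (n + 1) = E.path n - 1 ↔ E.arrowAt E.path n = Arrow.left := by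
  rw [path_succ]
  split_ifs with h
  · simp only [h, reduceCtorEq, iff_false]; omega
  · simp [Arrow.ne_right_iff.mp h]

/-- Following a prescribed trajectory up to time `n` is a condition on the arrows used before
time `n`. -/
theorem path_eq_iff (E : ArrowSystem) (e : ℕ → ℤ) (n : ℕ) :
    (∀ m ≤ n, E.path m = e m) ↔ e 0 = 0 ∧ ∀ m < n,
      e (m + 1) = if E.arrowAt e m = Arrow.right then e m + 1 else e m - 1 := by
  constructor
  · refine fun h => ⟨(h 0 (Nat.zero_le n)).symm, fun m hm => ?_⟩
    rw [← h (m + 1) hm, ← h m hm.le, path_succ, E.arrowAt_congr fun i hi => h i (hi.trans hm.le)]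
  · rintro ⟨h0, h⟩ m
    induction m using Nat.strong_induction_on with
    | _ m ih =>
      intro hm
      rcases m with _ | m
      · exact h0.symm
      · rw [path_succ, h m hm, ih m (by omega) (by omega),
          E.arrowAt_congr fun i hi => ih i (by omega) (by omega)]

end ArrowSystem

/-! ### Conditional expectations given a countable random variable -/

/-- Conditioning on a random variable with countably many values amounts to averaging over each of
its level sets. -/
theorem condExp_comap_ae_eq_of_countable {Ω β : Type*} [mΩ : MeasurableSpace Ω] {μ : Measure Ω}
    [IsFiniteMeasure μ] [Countable β] [mβ : MeasurableSpace β] [DiscreteMeasurableSpace β]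
    {H : Ω → β} (hH : Measurable H) {f : Ω → ℝ} (hf : Integrable f μ) {G : β → ℝ}
    (hG : Integrable (fun z => G (H z)) μ)
    (h : ∀ b, ∫ z in H ⁻¹' {b}, f z ∂μ = μ.real (H ⁻¹' {b}) * G b) :
    μ[f | mβ.comap H] =ᵐ[μ] fun z => G (H z) := by
  symm
  refine ae_eq_condExp_of_forall_setIntegral_eq hH.comap_le hf (fun s _ _ => hG.integrableOn) ?_ ?_
  · rintro _ ⟨T, -, rfl⟩ -
    have hT : H ⁻¹' T = ⋃ b : T, H ⁻¹' {(b : β)} := by ext; simp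
    have hm : ∀ b : T, MeasurableSet (H ⁻¹' {(b : β)}) := fun b => hH (.of_discrete)
    have hd : Pairwise (Function.onFun Disjoint fun b : T => H ⁻¹' {(b : β)}) := fun a b hab =>
      Disjoint.preimage _ (by simpa [Subtype.ext_iff] using hab)
    rw [hT, integral_iUnion hm hd hG.integrableOn, integral_iUnion hm hd hf.integrableOn]
    refine tsum_congr fun b => ?_
    rw [h, setIntegral_congr_fun (g := fun _ => G b) (hm b) fun z hz => by
      rw [Set.mem_preimage, Set.mem_singleton_iff] at hz
      simp [hz], setIntegral_const, smul_eq_mul]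
  · exact ((measurable_of_countable G).comp (comap_measurable H)).aestronglyMeasurable

/-! ### Independent arrows determine an excited random walk -/

/-- The law of an independent family of arrows, the arrow `i` pointing right with
probability `η i`. -/
noncomputable def arrowLaw {ι : Type*} (η : ι → unitInterval) : Measure (ι → Arrow) :=
  Measure.infinitePi fun i => bernoulliMeasure Arrow.right Arrow.left (η i)

instance {ι : Type*} (η : ι → unitInterval) : IsProbabilityMeasure (arrowLaw η) := by
  unfold arrowLaw; infer_instance

section

variable {Ω : Type*}

/-- The trajectory `X 0, …, X n`. -/
def trajectory (X : ℕ → Ω → ℤ) (n : ℕ) (z : Ω) : Fin (n + 1) → ℤ := fun i => X i z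

/-- A finite trajectory as a sequence, continued by its last value. -/
def extendTrajectory {n : ℕ} (h : Fin (n + 1) → ℤ) (m : ℕ) : ℤ := h (Fin.ofNat (n + 1) (min m n))

theorem extendTrajectory_trajectory (X : ℕ → Ω → ℤ) {m n : ℕ} (hm : m ≤ n) (z : Ω) :
    extendTrajectory (trajectory X n z) m = X m z := by
  simp [extendTrajectory, trajectory, hm, Nat.mod_eq_of_lt (Nat.lt_succ_of_le hm)]

theorem trajectory_eq_iff (X : ℕ → Ω → ℤ) {n : ℕ} (h : Fin (n + 1) → ℤ) (z : Ω) :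
    trajectory X n z = h ↔ ∀ m ≤ n, X m z = extendTrajectory h m := by
  constructor
  · rintro rfl m hm
    rw [extendTrajectory_trajectory X hm]
  · intro H
    ext ⟨i, hi⟩
    refine (H i (Nat.lt_succ_iff.mp hi)).trans ?_
    rw [extendTrajectory]
    congr 1
    ext
    simp [Nat.min_eq_left (Nat.lt_succ_iff.mp hi), Nat.mod_eq_of_lt hi]

variable [mΩ : MeasurableSpace Ω]

theorem measurable_trajectory {X : ℕ → Ω → ℤ} {n : ℕ} (h : ∀ m ≤ n, Measurable (X m)) :
    Measurable (trajectory X n) :=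
  measurable_pi_lambda _ fun i => h i (Nat.lt_succ_iff.mp i.2)

variable {μ : Measure Ω} {𝓛 : Ω → ArrowSystem} {ω : CookieEnv}

theorem measurable_path (h𝓛 : Measurable 𝓛) (n : ℕ) : Measurable fun z => (𝓛 z).path n := by
  induction n using Nat.strong_induction_on with
  | _ n ih =>
    rcases n with _ | n
    · exact measurable_const
    have hH := measurable_trajectory (X := fun n z => (𝓛 z).path n) fun m (hm : m ≤ n) =>
      ih m (by omega)
    -- A function of the arrow system and of the countable past is measurable.
    have hF : Measurable fun q : ArrowSystem × (Fin (n + 1) → ℤ) =>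
        if q.1.arrowAt (extendTrajectory q.2) n = Arrow.right
          then extendTrajectory q.2 n + 1 else extendTrajectory q.2 n - 1 :=
      measurable_from_prod_countable_left fun h =>
        (measurable_of_countable fun a : Arrow => if a = Arrow.right
          then extendTrajectory h n + 1 else extendTrajectory h n - 1).comp
        ((measurable_pi_apply (visitNumber (extendTrajectory h) n)).comp
          (measurable_pi_apply (extendTrajectory h n)))
    convert! hF.comp (h𝓛.prodMk hH) using 1
    ext z
    have hz : ∀ m ≤ n, extendTrajectory (trajectory (fun n z => (𝓛 z).path n) n z) m =
      (𝓛 z).path m := fun m hm => extendTrajectory_trajectory (fun n z => (𝓛 z).path n) hm z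
    simp only [Function.comp, (𝓛 z).arrowAt_congr hz, hz n le_rfl, (𝓛 z).path_succ]

/-- The arrow that a given trajectory uses next is independent of the event that the walk has
followed this trajectory, since that event involves other arrows only. -/
theorem measureReal_path_eq_inter (h𝓛 : Measurable 𝓛)
    (hind : iIndepFun (fun (p : ℤ × ℕ+) z => 𝓛 z p.1 p.2) μ) (e : ℕ → ℤ) (n : ℕ) (d : Arrow) :
    μ.real ({z | ∀ m ≤ n, (𝓛 z).path m = e m} ∩ {z | (𝓛 z).arrowAt e n = d}) =
      μ.real {z | ∀ m ≤ n, (𝓛 z).path m = e m} * μ.real {z | (𝓛 z).arrowAt e n = d} := by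
  classical
  let used : ℕ → ℤ × ℕ+ := fun m => (e m, visitNumber e m)
  let S := (Finset.range n).image used
  have hd : Disjoint S {used n} := by
    simp only [S, Finset.disjoint_singleton_right, Finset.mem_image, Finset.mem_range, not_exists,
      not_and]
    intro m hm h
    exact (visitNumber_lt hm (congrArg Prod.fst h)).ne (congrArg Prod.snd h)
  have hmeas : ∀ p : ℤ × ℕ+, Measurable fun z => 𝓛 z p.1 p.2 := fun p =>
    (measurable_pi_apply p.2).comp ((measurable_pi_apply p.1).comp h𝓛)
  have hI := hind.indepFun_finset S {used n} hd hmeas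
  let P : Set (S → Arrow) := {a | e 0 = 0 ∧ ∀ m, ∀ hm : m < n, e (m + 1) =
    if a ⟨used m, Finset.mem_image_of_mem _ (Finset.mem_range.mpr hm)⟩ = Arrow.right
      then e m + 1 else e m - 1}
  let Q : Set (({used n} : Finset (ℤ × ℕ+)) → Arrow) := {a | a ⟨used n, by simp⟩ = d}
  have h := hI.measure_inter_preimage_eq_mul P Q .of_discrete .of_discrete
  have hP : {z | ∀ m ≤ n, (𝓛 z).path m = e m} =
      (fun z (i : S) => 𝓛 z i.1.1 i.1.2) ⁻¹' P := by
    ext z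
    exact (𝓛 z).path_eq_iff e n
  rw [← hP] at h
  simp only [measureReal_def, ← ENNReal.toReal_mul]
  exact congrArg ENNReal.toReal h

/-- If the arrows are independent and point right with the probabilities given by the cookies, then
the walk that they determine is an excited random walk. -/
theorem isExcitedRandomWalk_path [IsProbabilityMeasure μ] (h𝓛 : Measurable 𝓛)
    (hlaw : μ.map (fun z (p : ℤ × ℕ+) => 𝓛 z p.1 p.2) = arrowLaw fun p : ℤ × ℕ+ => ω p.1 p.2) :
    IsExcitedRandomWalk ω (fun n z => (𝓛 z).path n) μ := by
  have hmeas : ∀ p : ℤ × ℕ+, Measurable fun z => 𝓛 z p.1 p.2 := fun p =>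
    (measurable_pi_apply p.2).comp ((measurable_pi_apply p.1).comp h𝓛)
  have hlaw1 : ∀ p : ℤ × ℕ+, μ.map (fun z => 𝓛 z p.1 p.2) =
      bernoulliMeasure Arrow.right Arrow.left (ω p.1 p.2) := fun p => by
    rw [← Measure.infinitePi_map_eval
      (fun p : ℤ × ℕ+ => bernoulliMeasure Arrow.right Arrow.left (ω p.1 p.2)) p]
    change _ = (arrowLaw fun p : ℤ × ℕ+ => ω p.1 p.2).map _
    rw [← hlaw, Measure.map_map (by fun_prop) (by fun_prop)]
    rfl
  have hind : iIndepFun (fun (p : ℤ × ℕ+) z => 𝓛 z p.1 p.2) μ := by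
    rw [iIndepFun_iff_map_fun_eq_infinitePi_map hmeas, hlaw]
    simp only [hlaw1]
    rfl
  let X : ℕ → Ω → ℤ := fun n z => (𝓛 z).path n
  have hX : ∀ n, Measurable (X n) := measurable_path h𝓛
  have hH : ∀ n, Measurable (trajectory X n) := fun n => measurable_trajectory fun m _ => hX m
  let ℱ : Filtration ℕ mΩ :=
    { seq := fun n => MeasurableSpace.comap (trajectory X n) inferInstance
      mono' := fun m n hmn => by
        have hr : Measurable fun (h : Fin (n + 1) → ℤ) (i : Fin (m + 1)) =>
          h (Fin.castLE (Nat.succ_le_succ hmn) i) := by fun_prop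
        exact (hr.comp (comap_measurable (trajectory X n))).comap_le
      le' := fun n => (hH n).comap_le }
  -- The law of the next arrow given the past.
  have key : ∀ (n : ℕ) (d : Arrow),
      μ[Set.indicator {z | (𝓛 z).arrowAt (𝓛 z).path n = d} (fun _ => (1 : ℝ)) | ℱ n]
      =ᵐ[μ] fun z => (bernoulliMeasure Arrow.right Arrow.left
        (ω (X n z) (visitNumber (fun i => X i z) n))).real {d} := by
    intro n d
    let G : (Fin (n + 1) → ℤ) → ℝ := fun h => (bernoulliMeasure Arrow.right Arrow.left
      (ω (extendTrajectory h n) (visitNumber (extendTrajectory h) n))).real {d}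
    have hG : (fun z => (bernoulliMeasure Arrow.right Arrow.left
        (ω (X n z) (visitNumber (fun i => X i z) n))).real {d}) =
        fun z => G (trajectory X n z) := by
      ext z
      simp only [G]
      rw [extendTrajectory_trajectory X le_rfl,
        visitNumber_congr fun m hm => extendTrajectory_trajectory X hm z]
    have hpast : ∀ h : Fin (n + 1) → ℤ, trajectory X n ⁻¹' {h} =
        {z | ∀ m ≤ n, (𝓛 z).path m = extendTrajectory h m} := fun h => by
      ext z
      exact trajectory_eq_iff X h z
    have hnext : ∀ h : Fin (n + 1) → ℤ,
        trajectory X n ⁻¹' {h} ∩ {z | (𝓛 z).arrowAt (𝓛 z).path n = d} =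
        trajectory X n ⁻¹' {h} ∩ {z | (𝓛 z).arrowAt (extendTrajectory h) n = d} := fun h => by
      ext z
      refine and_congr_right fun hz => ?_
      rw [hpast] at hz
      rw [Set.mem_ofPred_eq, Set.mem_ofPred_eq, (𝓛 z).arrowAt_congr hz]
    have hmA : ∀ e : ℕ → ℤ, MeasurableSet {z | (𝓛 z).arrowAt e n = d} := fun e =>
      hmeas (e n, visitNumber e n) (MeasurableSet.of_discrete (s := {d}))
    have hmN : MeasurableSet {z | (𝓛 z).arrowAt (𝓛 z).path n = d} := by
      have : {z | (𝓛 z).arrowAt (𝓛 z).path n = d} = ⋃ h : Fin (n + 1) → ℤ,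
          trajectory X n ⁻¹' {h} ∩ {z | (𝓛 z).arrowAt (𝓛 z).path n = d} := by
        ext z; simp
      rw [this]
      refine MeasurableSet.iUnion fun h => ?_
      rw [hnext]
      exact (hH n .of_discrete).inter (hmA _)
    rw [hG]
    refine condExp_comap_ae_eq_of_countable (hH n) ((integrable_const 1).indicator hmN) ?_ ?_
    · refine Integrable.of_bound
        ((measurable_of_countable G).comp (hH n)).aestronglyMeasurable 1 (ae_of_all _ fun z => ?_)
      rw [Real.norm_of_nonneg measureReal_nonneg]
      exact measureReal_le_one
    · intro h
      rw [setIntegral_indicator hmN, setIntegral_const, smul_eq_mul, mul_one, hnext, hpast,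
        measureReal_path_eq_inter h𝓛 hind, ← hpast]
      congr 1
      have := hlaw1 (extendTrajectory h n, visitNumber (extendTrajectory h) n)
      simp only [G]
      rw [← this, map_measureReal_apply (hmeas _) .of_discrete]
      rfl
  refine ⟨ℱ, fun n => ?_, ae_of_all _ fun z => (𝓛 z).isPath_path.1, fun n => ⟨?_, ?_⟩⟩
  · have : Measurable fun h : Fin (n + 1) → ℤ => h (Fin.last n) := by fun_prop
    exact (this.comp (comap_measurable (trajectory X n))).stronglyMeasurable
  · simpa [ArrowSystem.path_succ_eq_add_one_iff] using key n Arrow.right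
  · simpa [ArrowSystem.path_succ_eq_sub_one_iff] using key n Arrow.left

end

/-! ### The coupling of one block -/

/-- Let `T` be an involution and `G` a set of points containing exactly one point of each nontrivial
orbit of `T`, namely a heavier one for `p`. Moving the excess weight `p a - p (T a)` of each `a ∈ G`
from `a` to `T a` turns `p` into its image under `T`. -/
theorem PMF.exists_kernel_of_involutive {α : Type*} [Fintype α] (p : PMF α) {T : α → α}
    (hT : Function.Involutive T) {G : α → Prop} (hG : ∀ a, G a → ¬ G (T a))
    (hfix : ∀ a, G a ∨ G (T a) ∨ T a = a) (hle : ∀ a, G a → p (T a) ≤ p a) :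
    ∃ K : α → PMF α, (∀ b, p.bind K b = p (T b)) ∧
      ∀ a, ∀ b ∈ (K a).support, b = a ∨ G a ∧ b = T a := by
  classical
  -- The probability of staying at `a`.
  let ρ : α → ENNReal := fun a => if G a then p (T a) / p a else 1
  have hρ : ∀ a, ρ a ≤ 1 := fun a => by
    by_cases h : G a
    · simpa [ρ, h] using ENNReal.div_le_of_le_mul (by simpa using hle a h)
    · simp [ρ, h]
  have hmul : ∀ a, G a → p a * ρ a = p (T a) := fun a h => by
    simp only [ρ, h, if_true]
    by_cases h0 : p a = 0
    · have := hle a h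
      rw [h0, nonpos_iff_eq_zero] at this
      simp [h0, this]
    · exact ENNReal.mul_div_cancel h0 (p.apply_ne_top a)
  have hone : ∀ a, ¬ G a → ρ a = 1 := fun a h => by simp [ρ, h]
  let K : α → PMF α := fun a => PMF.ofFintype
    (fun b => (if b = a then ρ a else 0) + if b = T a then 1 - ρ a else 0) (by
      rw [Finset.sum_add_distrib, Finset.sum_ite_eq', Finset.sum_ite_eq']
      simpa using add_tsub_cancel_of_le (hρ a))
  refine ⟨K, fun b => ?_, fun a b hb => ?_⟩
  · have hK : p.bind K b = p b * ρ b + p (T b) * (1 - ρ (T b)) := by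
      have hTb : ∀ a, b = T a ↔ T b = a := fun a => hT.eq_iff.symm
      simp only [PMF.bind_apply, tsum_fintype, K, PMF.ofFintype_apply, mul_add, mul_ite, mul_zero,
        Finset.sum_add_distrib, hTb, Finset.sum_ite_eq, Finset.mem_univ, if_true]
    rw [hK]
    rcases hfix b with h | h | h
    · rw [hmul b h, hone _ (hG b h)]
      simp
    · have h' : ¬ G b := fun hb => hG b hb h
      have h2 := hmul _ h
      rw [hT b] at h2
      rw [hone b h', mul_one]
      conv_lhs => rw [← h2]
      rw [← mul_add, add_tsub_cancel_of_le (hρ _), mul_one]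
    · have h' : ¬ G b := fun hb => hG b hb (h.symm ▸ hb)
      rw [h, hone b h']
      simp
  · rw [PMF.mem_support_iff] at hb
    by_cases h : b = a
    · exact Or.inl h
    · refine Or.inr ?_
      by_cases h2 : b = T a
      · refine ⟨?_, h2⟩
        by_contra hGa
        exact hb (by simp [K, PMF.ofFintype_apply, h, hone a hGa])
      · exact absurd (by simp [K, PMF.ofFintype_apply, h, h2]) hb

section

variable {A : Set ℕ+} [Fintype A]

/-- The order on the arrows of a block: among the arrows at levels up to `r`, the configuration `a`
has at least as many left arrows as `b`, for all `r`. -/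
def BlockArrowsLE (a b : A → Arrow) : Prop :=
  ∀ r : ℕ+, (Finset.univ.filter fun s : A => (s : ℕ+) ≤ r ∧ b s = Arrow.left).card ≤
    (Finset.univ.filter fun s : A => (s : ℕ+) ≤ r ∧ a s = Arrow.left).card

theorem BlockArrowsLE.refl (a : A → Arrow) : BlockArrowsLE a a := fun _ => le_rfl

theorem BlockArrowsLE.trans {a b c : A → Arrow} (h : BlockArrowsLE a b) (h' : BlockArrowsLE b c) :
    BlockArrowsLE a c := fun r => (h' r).trans (h r)

/-- Exchanging a right arrow with an arrow below it increases the configuration, weakly. -/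
theorem blockArrowsLE_comp_swap {a : A → Arrow} {j k : A} (hjk : j ≤ k)
    (hk : a k = Arrow.right) : BlockArrowsLE a (a ∘ Equiv.swap j k) := by
  classical
  refine fun r => Finset.card_le_card_of_injOn (Equiv.swap j k) (fun s hs => ?_)
    (Equiv.injective _).injOn
  simp only [Finset.coe_filter, Finset.mem_univ, true_and, Set.mem_ofPred_eq,
    Function.comp_apply] at hs ⊢
  refine ⟨?_, hs.2⟩
  by_cases hsj : s = j
  · rw [hsj, Equiv.swap_apply_left, hk] at hs
    exact absurd hs.2 (by simp)
  by_cases hsk : s = k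
  · rw [hsk, Equiv.swap_apply_right]
    exact le_trans hjk (hsk ▸ hs.1)
  · rw [Equiv.swap_apply_of_ne_of_ne hsj hsk]
    exact hs.1

theorem arrowLaw_toPMF_apply {ι : Type*} [Fintype ι] (η : ι → unitInterval) (a : ι → Arrow) :
    (arrowLaw η).toPMF a = ∏ i, bernoulliMeasure Arrow.right Arrow.left (η i) {a i} := by
  rw [Measure.toPMF_apply, arrowLaw, Measure.infinitePi_singleton_of_fintype]

/-- Exchanging the parameters `j` and `k` is the same as exchanging the arrows `j` and `k`. -/
theorem arrowLaw_toPMF_comp_perm {ι : Type*} [Fintype ι] (η : ι → unitInterval)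
    (σ : Equiv.Perm ι) (a : ι → Arrow) :
    (arrowLaw (η ∘ σ)).toPMF (a ∘ σ) = (arrowLaw η).toPMF a := by
  rw [arrowLaw_toPMF_apply, arrowLaw_toPMF_apply]
  exact Equiv.prod_comp σ fun i => bernoulliMeasure Arrow.right Arrow.left (η i) {a i}

theorem arrowLaw_toPMF_comp_swap_le {ι : Type*} [Fintype ι] [DecidableEq ι] (η : ι → unitInterval)
    {a : ι → Arrow} {j k : ι} (hη : η j ≤ η k) (hj : a j = Arrow.left) (hk : a k = Arrow.right) :
    (arrowLaw η).toPMF (a ∘ Equiv.swap j k) ≤ (arrowLaw η).toPMF a := by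
  have hne : k ≠ j := fun h => by simp [h, hj] at hk
  have hsplit : ∀ f : ι → ENNReal, ∏ i, f i = f j * f k * ∏ i ∈ (Finset.univ.erase j).erase k, f i :=
    fun f => by
      rw [← Finset.mul_prod_erase _ f (Finset.mem_univ j),
        ← Finset.mul_prod_erase _ f (Finset.mem_erase.mpr ⟨hne, Finset.mem_univ k⟩), mul_assoc]
  have hright : ∀ p : unitInterval, bernoulliMeasure Arrow.right Arrow.left p {Arrow.right} =
      unitInterval.toNNReal p := fun p =>
    bernoulliMeasure_apply_of_mem_of_notMem p .of_discrete (by simp) (by simp)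
  have hleft : ∀ p : unitInterval, bernoulliMeasure Arrow.right Arrow.left p {Arrow.left} =
      unitInterval.toNNReal (unitInterval.symm p) := fun p =>
    bernoulliMeasure_apply_of_notMem_of_mem p .of_discrete (by simp) (by simp)
  rw [arrowLaw_toPMF_apply, arrowLaw_toPMF_apply, hsplit, hsplit]
  refine mul_le_mul' ?_ (Finset.prod_le_prod' fun i hi => ?_)
  · simp only [Function.comp_apply, Equiv.swap_apply_left, Equiv.swap_apply_right, hj, hk]
    rw [hright, hleft, hleft, hright, mul_comm]
    refine mul_le_mul' ?_ ?_
    · rw [ENNReal.coe_le_coe]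
      exact unitInterval.symm_le_symm.mpr hη
    · rw [ENNReal.coe_le_coe]
      exact hη
  · simp only [Finset.mem_erase] at hi
    simp [Equiv.swap_apply_of_ne_of_ne hi.2.1 hi.1]

/-- One favourable swap is realised by moving arrows of a random configuration upwards in the
order: a configuration with a left arrow at `j` and a right arrow at `k` is at least as likely as
the exchanged one, and the excess is moved. -/
theorem FavourableSwap.exists_kernel {η η' : A → unitInterval} (h : FavourableSwap η η') :
    ∃ K : (A → Arrow) → PMF (A → Arrow), (arrowLaw η).toPMF.bind K = (arrowLaw η').toPMF ∧
      ∀ a, ∀ b ∈ (K a).support, BlockArrowsLE a b := by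
  classical
  obtain ⟨j, k, hjk, hle, hj, hk, hne⟩ := h
  have hη' : η' = η ∘ Equiv.swap j k := by
    ext1 r
    by_cases hrj : r = j
    · simp [hrj, hj]
    by_cases hrk : r = k
    · simp [hrk, hk]
    · simp [Equiv.swap_apply_of_ne_of_ne hrj hrk, hne r hrj hrk]
  have hinv : Function.Involutive fun a : A → Arrow => a ∘ Equiv.swap j k := fun a => by
    ext1 r; simp
  let _ : Fintype (A → Arrow) := Fintype.ofFinite _
  obtain ⟨K, hK, hsupp⟩ := (arrowLaw η).toPMF.exists_kernel_of_involutive hinv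
    (G := fun a => a j = Arrow.left ∧ a k = Arrow.right) (fun a ha => by simp [ha.1, ha.2])
    (fun a => by
      cases haj : a j <;> cases hak : a k <;> simp [haj, hak]
      all_goals
        ext1 r
        by_cases hrj : r = j
        · simp [hrj, haj, hak]
        by_cases hrk : r = k
        · simp [hrk, haj, hak]
        · simp [Equiv.swap_apply_of_ne_of_ne hrj hrk])
    (fun a ha => arrowLaw_toPMF_comp_swap_le η hle ha.1 ha.2)
  refine ⟨K, PMF.ext fun b => ?_, fun a b hb => ?_⟩
  · rw [hK, hη', ← arrowLaw_toPMF_comp_perm η (Equiv.swap j k)]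
    congr 1
    exact hinv b
  · rcases hsupp a b hb with rfl | ⟨hG, rfl⟩
    · exact .refl _
    · exact blockArrowsLE_comp_swap hjk hG.2

theorem exists_kernel_of_reflTransGen {η η' : A → unitInterval}
    (h : Relation.ReflTransGen FavourableSwap η η') :
    ∃ K : (A → Arrow) → PMF (A → Arrow), (arrowLaw η).toPMF.bind K = (arrowLaw η').toPMF ∧
      ∀ a, ∀ b ∈ (K a).support, BlockArrowsLE a b := by
  induction h with
  | refl =>
    refine ⟨PMF.pure, PMF.bind_pure _, fun a b hb => ?_⟩
    rw [(PMF.mem_support_pure_iff a b).mp hb]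
    exact .refl a
  | tail _ h ih =>
    obtain ⟨K, hK, hs⟩ := ih
    obtain ⟨K', hK', hs'⟩ := h.exists_kernel
    refine ⟨fun a => (K a).bind K', by rw [← PMF.bind_bind, hK, hK'], fun a c hc => ?_⟩
    obtain ⟨b, hb, hc⟩ := (PMF.mem_support_bind_iff _ _ _).mp hc
    exact (hs a b hb).trans (hs' b c hc)

theorem exists_coupling_of_reflTransGen {η η' : A → unitInterval}
    (h : Relation.ReflTransGen FavourableSwap η η') :
    ∃ J : Measure ((A → Arrow) × (A → Arrow)), IsProbabilityMeasure J ∧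
      J.map Prod.fst = arrowLaw η ∧ J.map Prod.snd = arrowLaw η' ∧
      ∀ᵐ q ∂J, BlockArrowsLE q.1 q.2 := by
  obtain ⟨K, hK, hs⟩ := exists_kernel_of_reflTransGen h
  let J := (arrowLaw η).toPMF.bind fun a => (K a).map (Prod.mk a)
  refine ⟨J.toMeasure, inferInstance, ?_, ?_, ?_⟩
  · rw [PMF.toMeasure_map _ _ measurable_fst, ← (arrowLaw η).toPMF_toMeasure]
    congr 1
    simp only [J, PMF.map_bind, PMF.map_comp]
    exact (congrArg _ (funext fun a => PMF.map_const (K a) a)).trans (PMF.bind_pure _)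
  · rw [PMF.toMeasure_map _ _ measurable_snd, ← (arrowLaw η').toPMF_toMeasure, ← hK]
    congr 1
    simp only [J, PMF.map_bind, PMF.map_comp]
    exact congrArg _ (funext fun a => PMF.map_id (K a))
  · rw [ae_iff, PMF.toMeasure_apply_eq_zero_iff _ .of_discrete, Set.disjoint_left]
    intro q hq hn
    obtain ⟨a, -, hq⟩ := (PMF.mem_support_bind_iff _ _ _).mp hq
    obtain ⟨b, hb, rfl⟩ := (PMF.mem_support_map_iff _ _ _).mp hq
    exact hn (hs a b hb)

end

/-! ### Assembling the blocks -/

/-- Counting left arrows block by block, the order on each block gives the order on arrow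
systems. -/
theorem ArrowSystem.preceq_of_blockArrowsLE {𝒜 : ℤ → Set (Set ℕ+)}
    [∀ x, ∀ B : 𝒜 x, Fintype B.1] (b : ∀ x, ℕ+ → 𝒜 x)
    (hb : ∀ x (B : 𝒜 x), ∀ r ∈ B.1, b x r = B) (hmem : ∀ x r, r ∈ (b x r).1)
    {L R : ArrowSystem}
    (h : ∀ x r, BlockArrowsLE (fun s : (b x r).1 => L x s) fun s : (b x r).1 => R x s) :
    L.Preceq R := by
  classical
  intro x r
  have hcount : ∀ E : ArrowSystem, E.leftCount x r =
      ∑ B ∈ (Finset.Icc 1 r).image (b x),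
        (Finset.univ.filter fun s : B.1 => (s : ℕ+) ≤ r ∧ E x s = Arrow.left).card := fun E => by
    rw [ArrowSystem.leftCount, Finset.card_eq_sum_card_fiberwise (f := b x)
      (t := (Finset.Icc 1 r).image (b x)) fun s hs =>
        Finset.mem_image_of_mem _ (Finset.mem_filter.mp hs).1]
    refine Finset.sum_congr rfl fun B _ => ?_
    symm
    refine Finset.card_bij (fun s _ => (s : ℕ+)) (fun s hs => ?_) (fun s _ t _ => Subtype.ext)
      fun s hs => ?_
    · simp only [Finset.mem_filter, Finset.mem_univ, true_and, Finset.mem_Icc] at hs ⊢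
      exact ⟨⟨⟨one_le, hs.1⟩, hs.2⟩, hb x B s s.2⟩
    · simp only [Finset.mem_filter, Finset.mem_Icc] at hs
      exact ⟨⟨s, hs.2 ▸ hmem x s⟩, by simp [hs.1.1.2, hs.1.2], rfl⟩
  rw [hcount, hcount]
  refine Finset.sum_le_sum fun B hB => ?_
  obtain ⟨s, -, rfl⟩ := Finset.mem_image.mp hB
  exact h x s r

/-- Independent block configurations with independent arrows form a family of independent
arrows, here read off along an injective indexing `e` of the arrows by blocks. -/
theorem map_infinitePi_eq_arrowLaw {I α : Type*} {κ : I → Type*} {Y : I → Type*}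
    [∀ i, MeasurableSpace (Y i)] (J : ∀ i, Measure (Y i)) [∀ i, IsProbabilityMeasure (J i)]
    {f : ∀ i, Y i → κ i → Arrow} (hf : ∀ i, Measurable (f i)) {η : ∀ i, κ i → unitInterval}
    (hJ : ∀ i, (J i).map (f i) = arrowLaw (η i)) {e : α → Σ i, κ i} (he : e.Injective) :
    (Measure.infinitePi J).map (fun z p => f (e p).1 (z (e p).1) (e p).2) =
      arrowLaw fun p => η (e p).1 (e p).2 := by
  have h1 := Measure.infinitePi_map_pi (μ := J) hf
  simp only [hJ] at h1
  have h2 := Measure.infinitePi_map_piCurry_symm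
    (μ := fun i k => bernoulliMeasure Arrow.right Arrow.left (η i k))
  have h3 := Measure.map_infinitePi_infinitePi_of_inj
    (P := fun p : Σ i, κ i => bernoulliMeasure Arrow.right Arrow.left (η p.1 p.2)) he
  change _ = Measure.infinitePi fun p => bernoulliMeasure Arrow.right Arrow.left
    (η (e p).1 (e p).2)
  unfold arrowLaw at h1
  rw [← h3, ← h2, ← h1, Measure.map_map (by fun_prop) (by fun_prop),
    Measure.map_map (by fun_prop) (by fun_prop)]
  rfl

theorem mainTheorem5 (𝒜 : ℤ → Set (Set ℕ+)) (h𝒜 : IsBlockPartition 𝒜) (ω ω' : CookieEnv)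
    (hω : CookieEnv.BlockPreceq 𝒜 ω ω') :
    ∃ (Ω : Type) (_ : MeasurableSpace Ω) (μ : Measure Ω) (_ : IsProbabilityMeasure μ)
      (E E' : ℕ → Ω → ℤ),
      IsExcitedRandomWalk ω E μ ∧ IsExcitedRandomWalk ω' E' μ ∧
        ∀ᵐ z ∂μ, PathPreceq (fun n => E n z) (fun n => E' n z) := by
  let _ : ∀ x, ∀ B : 𝒜 x, Fintype B.1 := fun x B => ((h𝒜 x).2 B.1 B.2).fintype
  -- The block containing the level `r` at the site `x`.
  have hblock : ∀ x r, ∃ B : 𝒜 x, r ∈ B.1 ∧ ∀ C : 𝒜 x, r ∈ C.1 → B = C := fun x r => by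
    obtain ⟨B, ⟨hB, hr⟩, huniq⟩ := (h𝒜 x).1.2 r
    exact ⟨⟨B, hB⟩, hr, fun C hC => Subtype.ext (huniq C ⟨C.2, hC⟩).symm⟩
  choose b hmem hb using hblock
  let I := Σ x : ℤ, 𝒜 x
  choose J hJprob hJ hJ' hJle using fun i : I =>
    exists_coupling_of_reflTransGen (hω.2 i.1 i.2.1 i.2.2)
  let e : ℤ × ℕ+ → Σ i : I, i.2.1 := fun p => ⟨⟨p.1, b p.1 p.2⟩, ⟨p.2, hmem p.1 p.2⟩⟩
  have he : e.Injective := by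
    have hleft : Function.LeftInverse (fun q : Σ i : I, i.2.1 => (q.1.1, (q.2 : ℕ+))) e :=
      fun _ => rfl
    exact hleft.injective
  let 𝓛 : (∀ i : I, (i.2.1 → Arrow) × (i.2.1 → Arrow)) → ArrowSystem :=
    fun z x r => (z ⟨x, b x r⟩).1 ⟨r, hmem x r⟩
  let 𝓡 : (∀ i : I, (i.2.1 → Arrow) × (i.2.1 → Arrow)) → ArrowSystem :=
    fun z x r => (z ⟨x, b x r⟩).2 ⟨r, hmem x r⟩
  have h𝓛 : Measurable 𝓛 := measurable_pi_lambda _ fun x => measurable_pi_lambda _ fun r =>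
    (measurable_pi_apply _).comp (measurable_fst.comp (measurable_pi_apply _))
  have h𝓡 : Measurable 𝓡 := measurable_pi_lambda _ fun x => measurable_pi_lambda _ fun r =>
    (measurable_pi_apply _).comp (measurable_snd.comp (measurable_pi_apply _))
  refine ⟨∀ i : I, (i.2.1 → Arrow) × (i.2.1 → Arrow), inferInstance, Measure.infinitePi J,
    inferInstance, fun n z => (𝓛 z).path n, fun n z => (𝓡 z).path n,
    isExcitedRandomWalk_path h𝓛 (map_infinitePi_eq_arrowLaw J (fun _ => measurable_fst) hJ he),
    isExcitedRandomWalk_path h𝓡 (map_infinitePi_eq_arrowLaw J (fun _ => measurable_snd) hJ' he),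
    ?_⟩
  have hae : ∀ᵐ z ∂Measure.infinitePi J, ∀ x r,
      BlockArrowsLE (z ⟨x, b x r⟩).1 (z ⟨x, b x r⟩).2 := by
    refine ae_all_iff.mpr fun x => ae_all_iff.mpr fun r => ?_
    exact (measurePreserving_eval_infinitePi J ⟨x, b x r⟩).quasiMeasurePreserving.ae (hJle _)
  filter_upwards [hae] with z hz
  refine ⟨𝓛 z, 𝓡 z, ?_, (𝓛 z).isPath_path, (𝓡 z).isPath_path⟩
  refine ArrowSystem.preceq_of_blockArrowsLE b (fun x B r hr => hb x r B hr) hmem fun x r => ?_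
  -- The arrow system restricted to a block is the configuration of that block.
  have hrestrict : ∀ f : ∀ i : I, i.2.1 → Arrow,
      (fun s : (b x r).1 => f ⟨x, b x s⟩ ⟨s, hmem x s⟩) = f ⟨x, b x r⟩ := fun f => by
    ext1 s
    have key : ∀ (B C : 𝒜 x) (s : ℕ+) (hB : s ∈ B.1) (hC : s ∈ C.1), B = C →
        f ⟨x, B⟩ ⟨s, hB⟩ = f ⟨x, C⟩ ⟨s, hC⟩ := by
      rintro B _ s hB hC rfl
      rfl
    exact key _ _ _ _ _ (hb x s (b x r) s.2)
  have h := hz x r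
  rw [← hrestrict fun i => (z i).1, ← hrestrict fun i => (z i).2] at h
  exact h
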